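/- Let $n\in\mathbb{N}$ and let $\theta_1,\dots,\theta_n$ be real numbers, $z_i=e^{-i\theta_i}$. On the Hilbert space $L^2(\mathbb{R})^n=L^2(\mathbb{R})\oplus\dots\oplus L^2(\mathbb{R})$ (complex-valued functions, Lebesgue measure) let $T$ be the unitary operator $T(f_1,\dots,f_n)=(z_1f_1(\cdot-1),\dots,z_nf_n(\cdot-1))$, so that $(T^kf)_i=e^{-ik\theta_i}f_i(\cdot-k)$ for $k\in\mathbb{Z}$. Let $\hat f(\xi)=\int_{\mathbb{R}}f(x)e^{-i\xi x}\,dx$ denote the Fourier transform (extended to $L^2(\mathbb{R})$ by continuity), applied componentwise. A subset $\Phi$ of a subspace $V\subset L^2(\mathbb{R})^n$ with $T^kV\subset V$ for all $k\in\mathbb{Z}$ is called a normalized tight frame (NTF) generator for $V$ if the family $(T^k\varphi)_{k\in\mathbb{Z},\,\varphi\in\Phi}$ is a normalized tight frame for $V$, i.e. $\sum_{\varphi\in\Phi}\sum_{k\in\mathbb{Z}}|\langle f,T^k\varphi\rangle|^2=\|f\|^2$ for all $f\in V$. Let $\Phi$ be a countable subset of $L^2(\mathbb{R})^n$. The following are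 equivalent: (i) $\Phi$ is an NTF generator for $L^2(\mathbb{R})^n$; (ii) for all $i,j\in\{1,\dots,n\}$ and all $k\in\mathbb{Z}$, for almost every $\xi\in\mathbb{R}$, the following series converges absolutely and $$\sum_{\varphi\in\Phi}\hat\varphi_i(\xi-\theta_i)\,\overline{\hat\varphi_j(\xi-\theta_j+2k\pi)}=\delta_{ij}\,\delta_{k,0}.$$ -/

import Mathlib

open MeasureTheory
open scoped FourierTransform ComplexConjugate

noncomputable section

namespace SuperWavelet

/-- The Hilbert space `L²(ℝ)`, Lebesgue measure, complex valued. -/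
abbrev L2R : Type := Lp ℂ 2 (volume : Measure ℝ)

/-- The Hilbert space `L²(ℝ)ⁿ = L²(ℝ) ⊕ ⋯ ⊕ L²(ℝ)` (orthogonal direct sum of `n` copies). -/
abbrev L2Rn (n : ℕ) : Type := PiLp 2 (fun _ : Fin n => L2R)

/-- The translation `f ↦ f(· - a)` on `L²(ℝ)`. -/
def translateL2 (a : ℝ) (f : L2R) : L2R :=
  Lp.compMeasurePreserving (fun x : ℝ => x - a) (measurePreserving_sub_right volume a) f

/-- The `k`-th power `T^k` of the shift `T = (z₁ T₀, …, zₙ T₀)` on `L²(ℝ)ⁿ`, where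
`T₀ f = f(· - 1)` and `z_i = e^{-i θ_i}`; thus `(T^k f)_i = e^{-i k θ_i} f_i(· - k)`. -/
def shift {n : ℕ} (θ : Fin n → ℝ) (k : ℤ) (f : L2Rn n) : L2Rn n :=
  WithLp.toLp 2 fun i =>
    Complex.exp (-Complex.I * (k : ℂ) * (θ i : ℂ)) • translateL2 (k : ℝ) (f i)

/-- A family `(e_i)` is a normalized tight frame for the subspace `V` of a Hilbert space:
its members lie in `V` and `∑ |⟨f, e_i⟩|² = ‖f‖²` for all `f ∈ V`. -/
def IsNormalizedTightFrame {H : Type*} [NormedAddCommGroup H] [InnerProductSpace ℂ H]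
    {ι : Type*} (V : Submodule ℂ H) (e : ι → H) : Prop :=
  (∀ i, e i ∈ V) ∧ ∀ f ∈ V, HasSum (fun i => ‖inner ℂ (e i) f‖ ^ 2) (‖f‖ ^ 2)

/-- A subspace is shift invariant if `T^k V ⊆ V` for all `k ∈ ℤ`. -/
def IsShiftInvariant {n : ℕ} (θ : Fin n → ℝ) (V : Submodule ℂ (L2Rn n)) : Prop :=
  ∀ (k : ℤ), ∀ f ∈ V, shift θ k f ∈ V

/-- `Φ` is a normalized tight frame generator for the shift invariant subspace `V`: `Φ ⊆ V` and
the family `T^k φ`, indexed by `k ∈ ℤ` and `φ ∈ Φ`, is a normalized tight frame for `V`. -/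
structure IsNTFGenerator {n : ℕ} (θ : Fin n → ℝ) (V : Submodule ℂ (L2Rn n))
    (Φ : Set (L2Rn n)) : Prop where
  shiftInvariant : IsShiftInvariant θ V
  subset : Φ ⊆ (V : Set (L2Rn n))
  frame : IsNormalizedTightFrame V (fun p : ℤ × Φ => shift θ p.1 (p.2 : L2Rn n))

/-- The Fourier transform `f̂(ξ) = ∫ f(x) e^{-i ξ x} dx` on `L²(ℝ)` (extended by continuity), as an
almost everywhere determined function: Mathlib's `𝓕 f` at `w` is `∫ f(x) e^{-2 π i x w} dx`
(extended by continuity), evaluated here at `w = ξ / (2π)`. -/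
def fourierHat (f : L2R) (ξ : ℝ) : ℂ :=
  (𝓕 f : L2R) (ξ / (2 * Real.pi))

end SuperWavelet

end

/-! Rescale frequency by 2π and cut the line of component i into unit cells starting at m -
θ_i/(2π). An element of L²(ℝ)ⁿ then becomes a field of fibers over w in (0,1], with one entry for
each index a = (i, m). The offset of the cells absorbs the phases z_i, so T^k multiplies every entry
of the transformed fiber by the same scalar e^{-2πikw} (`sample_fourierRn_shift`).

Hence, for f with finitely many nonzero, bounded entries, Parseval for Fourier series turns the sum
over k of |⟨T^k φ, f⟩|² into the integral over (0,1] of the squared fiber inner product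
(`tsum_enorm_inner_shift_sq`). After summation over Φ, the frame identity compares two integrals,
and it amounts to a Parseval identity in almost every fiber. This says that the rows (entry a as φ
varies) are orthonormal in ℓ²(Φ), which is `FiberGram`.

Orthonormality gives the frame identity on finite combinations of cells, hence everywhere by
density. Conversely, test vectors supported over arbitrary measurable sets localize the identity in
w, and polarization recovers the Gram relations. Condition (ii) is `FiberGram` read at ξ = 2π(w +
m), with k the difference of the two cell numbers. -/

noncomputable section

namespace SuperWavelet

/-! ### Parseval identities: extension by density, and Fourier series -/

/-- A real sum of squared norms, rewritten as an extended nonnegative sum. -/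
theorem hasSum_norm_sq_iff_tsum_enorm {ι E F : Type*} [SeminormedAddCommGroup E]
    [SeminormedAddCommGroup F] (x : ι → E) (y : F) :
    HasSum (fun i => ‖x i‖ ^ 2) (‖y‖ ^ 2) ↔ ∑' i, ‖x i‖ₑ ^ 2 = ‖y‖ₑ ^ 2 := by
  have h1 : HasSum (fun i => ‖x i‖ ^ 2) (‖y‖ ^ 2) ↔
      HasSum (fun i => ‖x i‖₊ ^ 2) (‖y‖₊ ^ 2) := by
    rw [← NNReal.hasSum_coe]; simp
  rw [h1, ← ENNReal.hasSum_coe]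
  simp only [ENNReal.coe_pow, ← enorm_eq_nnnorm]
  exact ENNReal.summable.hasSum_iff

/-- The frame identity extends from a dense subspace to the whole space. -/
theorem hasSum_norm_inner_sq_of_dense {H ι : Type*} [NormedAddCommGroup H]
    [InnerProductSpace ℂ H] (e : ι → H) {D : Set H} (hD : Dense D)
    (h : ∀ f ∈ D, HasSum (fun i => ‖inner ℂ (e i) f‖ ^ 2) (‖f‖ ^ 2)) (f : H) :
    HasSum (fun i => ‖inner ℂ (e i) f‖ ^ 2) (‖f‖ ^ 2) := by
  -- Bessel's inequality survives limits because finite partial sums are continuous. It makes the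
  -- analysis operator `A` bounded into ℓ², so the norm identity passes from `D` to its closure.
  have hb : ∀ (s : Finset ι) (f : H), ∑ i ∈ s, ‖inner ℂ (e i) f‖ ^ 2 ≤ ‖f‖ ^ 2 := by
    intro s
    have hc : IsClosed {f : H | ∑ i ∈ s, ‖inner ℂ (e i) f‖ ^ 2 ≤ ‖f‖ ^ 2} :=
      isClosed_le (by fun_prop) (by fun_prop)
    have := (hc.closure_subset_iff (s := D)).2 fun f hf =>
      sum_le_hasSum s (fun i _ => by positivity) (h f hf)
    intro f
    exact this (hD f)
  have hmem : ∀ f : H, Memℓp (fun i => inner ℂ (e i) f) 2 := fun f =>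
    memℓp_gen' (C := ‖f‖ ^ 2) fun s => by simpa using hb s f
  have hnorm : ∀ f : H, HasSum (fun i => ‖inner ℂ (e i) f‖ ^ 2)
      (‖(⟨_, hmem f⟩ : lp (fun _ : ι => ℂ) 2)‖ ^ 2) := fun f => by
    simpa using lp.hasSum_norm (p := 2) (by simp) (⟨_, hmem f⟩ : lp (fun _ : ι => ℂ) 2)
  let A : H →ₗ[ℂ] lp (fun _ : ι => ℂ) 2 :=
    { toFun := fun f => ⟨fun i => inner ℂ (e i) f, hmem f⟩
      map_add' := fun f g => by ext i; exact inner_add_right _ _ _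
      map_smul' := fun c f => by ext i; exact inner_smul_right _ _ _ }
  have hA : ∀ f, ‖A f‖ ≤ 1 * ‖f‖ := fun f => by
    rw [one_mul]
    exact le_of_sq_le_sq (hasSum_le_of_sum_le (hnorm f) fun s => hb s f) (norm_nonneg _)
  have hcont : Continuous A := (A.mkContinuous 1 hA).continuous
  have key : (fun f => ‖A f‖ ^ 2) = fun f => ‖f‖ ^ 2 :=
    Continuous.ext_on hD (by fun_prop) (by fun_prop) fun f hf => (hnorm f).unique (h f hf)
  rw [← congrFun key f]
  exact hnorm f

/-- Parseval's identity on the unit interval. -/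
theorem tsum_enorm_integral_exp_mul_sq {b : ℝ → ℂ}
    (hb : MemLp b 2 (volume.restrict (Set.Ioc 0 1))) :
    ∑' k : ℤ, ‖∫ w in Set.Ioc (0 : ℝ) 1,
      Complex.exp (2 * Real.pi * Complex.I * k * w) * b w‖ₑ ^ 2 =
      ∫⁻ w in Set.Ioc (0 : ℝ) 1, ‖b w‖ₑ ^ 2 := by
  have h := hasSum_sq_fourierCoeffOn zero_lt_one hb
  have hint : Integrable (fun w => ‖b w‖ ^ 2) (volume.restrict (Set.Ioc (0 : ℝ) 1)) :=
    hb.integrable_norm_pow (by simp)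
  -- The exponent is +k, whereas the k-th Fourier coefficient integrates against frequency -k.
  rw [← (Equiv.neg ℤ).hasSum_iff] at h
  have h0 : (0 : ℝ) ≤ ∫ w in Set.Ioc (0 : ℝ) 1, ‖b w‖ ^ 2 :=
    integral_nonneg fun _ => by positivity
  have hk : ∀ k : ℤ, fourierCoeffOn zero_lt_one b (-k) = ∫ w in Set.Ioc (0 : ℝ) 1,
      Complex.exp (2 * Real.pi * Complex.I * k * w) * b w := by
    intro k
    rw [fourierCoeffOn_eq_integral, intervalIntegral.integral_of_le zero_le_one]
    simp only [sub_zero, div_one, one_smul, neg_neg, smul_eq_mul]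
    refine integral_congr_ae (.of_forall fun w => ?_)
    simp only [fourier_coe_apply]
    congr 2
    simp
  have hs : Real.sqrt (∫ w in Set.Ioc (0 : ℝ) 1, ‖b w‖ ^ 2) ^ 2 =
      ∫ w in Set.Ioc (0 : ℝ) 1, ‖b w‖ ^ 2 := Real.sq_sqrt h0
  have h2 : HasSum (fun k : ℤ => ‖∫ w in Set.Ioc (0 : ℝ) 1,
      Complex.exp (2 * Real.pi * Complex.I * k * w) * b w‖ ^ 2)
      (‖Real.sqrt (∫ w in Set.Ioc (0 : ℝ) 1, ‖b w‖ ^ 2)‖ ^ 2) := by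
    rw [Real.norm_of_nonneg (Real.sqrt_nonneg _), hs]
    simpa [Function.comp_def, hk, intervalIntegral.integral_of_le] using h
  rw [(hasSum_norm_sq_iff_tsum_enorm _ _).1 h2, ← ofReal_norm,
    Real.norm_of_nonneg (Real.sqrt_nonneg _), ← ENNReal.ofReal_pow (Real.sqrt_nonneg _), hs,
    ofReal_integral_eq_lintegral_ofReal hint (.of_forall fun _ => by positivity)]
  refine lintegral_congr fun w => ?_
  rw [ENNReal.ofReal_pow (norm_nonneg _), ofReal_norm]

/-! ### Translation and modulation -/

theorem coeFn_translateL2 (a : ℝ) (f : L2R) :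
    translateL2 a f =ᵐ[volume] fun x => f (x - a) :=
  Lp.coeFn_compMeasurePreserving f (measurePreserving_sub_right volume a)

/-- Translation becomes modulation under the Fourier transform on `L²(ℝ)`. -/
theorem fourier_translateL2 (a : ℝ) (f : L2R) :
    (𝓕 (translateL2 a f) : L2R) =ᵐ[volume]
      fun w => Complex.exp (-(2 * Real.pi * Complex.I * a * w)) * (𝓕 f : L2R) w := by
  set m : ℝ → ℂ := fun w => Complex.exp (-(2 * Real.pi * Complex.I * a * w)) with hm
  have hmc : Continuous m := by fun_prop
  have hm1 : ∀ w, ‖m w‖ = 1 := fun w => by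
    have : -(2 * Real.pi * Complex.I * a * w) = ((-(2 * Real.pi * a * w) : ℝ) : ℂ) * Complex.I := by
      push_cast; ring
    rw [hm]; simp only; rw [this, Complex.norm_exp_ofReal_mul_I]
  have hmem : ∀ g : L2R, MemLp (fun w => m w * g w) 2 volume := fun g =>
    (Lp.memLp g).of_le (hmc.aestronglyMeasurable.mul (Lp.aestronglyMeasurable g))
      (.of_forall fun w => by simp [hm1])
  have hiso : Isometry fun g : L2R => (hmem g).toLp := by
    refine Isometry.of_dist_eq fun g h => ?_
    rw [Lp.dist_def, Lp.dist_def]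
    congr 1
    refine eLpNorm_congr_norm_ae ?_
    filter_upwards [(hmem g).coeFn_toLp, (hmem h).coeFn_toLp] with w hg hh
    simp [hg, hh, ← mul_sub, hm1]
  have htr : Continuous (translateL2 a) :=
    (Lp.isometry_compMeasurePreserving (measurePreserving_sub_right volume a)).continuous
  -- Both sides are continuous in `f`, so Schwartz functions suffice; for them it is a change of
  -- variable in the Fourier integral.
  suffices h : (𝓕 (translateL2 a f) : L2R) = (hmem (𝓕 f)).toLp by
    rw [h]; exact (hmem (𝓕 f)).coeFn_toLp
  refine DenseRange.induction_on
    (p := fun f : L2R => (𝓕 (translateL2 a f) : L2R) = (hmem (𝓕 f)).toLp)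
    (SchwartzMap.denseRange_toLpCLM (p := 2) ENNReal.ofNat_ne_top) f ?_ ?_
  · exact isClosed_eq ((Lp.fourierTransformₗᵢ ℝ ℂ).continuous.comp htr)
      (hiso.continuous.comp (Lp.fourierTransformₗᵢ ℝ ℂ).continuous)
  · intro g
    simp only [SchwartzMap.toLpCLM_apply]
    have h1 : translateL2 a (g.toLp 2) = (SchwartzMap.compSubConstCLM ℂ a g).toLp 2 := by
      refine Lp.ext ?_
      filter_upwards [coeFn_translateL2 a (g.toLp 2), 
        SchwartzMap.coeFn_toLp (SchwartzMap.compSubConstCLM ℂ a g) 2,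
        (measurePreserving_sub_right volume a).quasiMeasurePreserving.ae
          (SchwartzMap.coeFn_toLp g 2 volume)] with x h1 h2 h3
      rw [h1, h2, h3]; simp
    have h2 : (𝓕 (g.toLp 2) : L2R) =ᵐ[volume] ⇑(𝓕 g : SchwartzMap ℝ ℂ) := by
      rw [SchwartzMap.toLp_fourier_eq]; exact SchwartzMap.coeFn_toLp (𝓕 g) 2 volume
    have h3 : (𝓕 (translateL2 a (g.toLp 2)) : L2R) =ᵐ[volume]
        ⇑(𝓕 (SchwartzMap.compSubConstCLM ℂ a g) : SchwartzMap ℝ ℂ) := by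
      rw [h1, SchwartzMap.toLp_fourier_eq]; exact SchwartzMap.coeFn_toLp _ 2 volume
    refine Lp.ext ?_
    filter_upwards [(hmem (𝓕 (g.toLp 2))).coeFn_toLp, h2, h3] with w h5 h6 h7
    refine h7.trans (Eq.trans ?_ h5.symm)
    rw [h6, SchwartzMap.fourier_coe, SchwartzMap.fourier_coe,
      Real.fourier_real_eq_integral_exp_smul, Real.fourier_real_eq_integral_exp_smul,
      ← integral_const_mul, ← integral_add_right_eq_self _ a]
    refine integral_congr_ae (.of_forall fun x => ?_)
    simp only [hm, SchwartzMap.compSubConstCLM_apply, add_sub_cancel_right, smul_eq_mul,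
      ← mul_assoc, ← Complex.exp_add]
    congr 2
    push_cast
    ring

/-! ### Cells in frequency space and their fibers -/

variable {n : ℕ}

/-- The componentwise Fourier transform on `L²(ℝ)ⁿ`, in Mathlib's normalization. -/
def fourierRn (n : ℕ) : L2Rn n ≃ₗᵢ[ℂ] L2Rn n :=
  LinearIsometryEquiv.piLpCongrRight 2 fun _ => Lp.fourierTransformₗᵢ ℝ ℂ

theorem fourierRn_apply (f : L2Rn n) (i : Fin n) : fourierRn n f i = 𝓕 (f i) := rfl

/-- Left endpoint of the unit frequency cell with index `a`. -/
def cellStart (θ : Fin n → ℝ) (a : Fin n × ℤ) : ℝ := a.2 - θ a.1 / (2 * Real.pi)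

/-- The values of `F` on the cell with index `a`, transported to the unit interval. -/
def sample (θ : Fin n → ℝ) (F : L2Rn n) (a : Fin n × ℤ) (w : ℝ) : ℂ :=
  F a.1 (w + cellStart θ a)

/-- The bounded elements of `L²(ℝ)ⁿ` supported on the cell with index `a`. -/
def cell (θ : Fin n → ℝ) (a : Fin n × ℤ) : Submodule ℂ (L2Rn n) where
  carrier := {F | (∀ j ≠ a.1, F j = 0) ∧
    (∀ᵐ w, w ∉ Set.Ioc (cellStart θ a) (cellStart θ a + 1) → F a.1 w = 0) ∧
    ∃ C : ℝ, ∀ᵐ w, ‖F a.1 w‖ ≤ C}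
  zero_mem' := by
    have h0 : ∀ᵐ w, (0 : L2R) w = 0 := Lp.coeFn_zero ℂ 2 volume
    refine ⟨fun j _ => rfl, h0.mono fun w h _ => h, 0, h0.mono fun w h => ?_⟩
    change ‖(0 : L2R) w‖ ≤ 0
    rw [h, norm_zero]
  add_mem' := by
    rintro F G ⟨hF1, hF2, C, hF3⟩ ⟨hG1, hG2, D, hG3⟩
    have h := Lp.coeFn_add (F a.1) (G a.1)
    refine ⟨fun j hj => by simp [hF1 j hj, hG1 j hj], ?_, C + D, ?_⟩
    · filter_upwards [h, hF2, hG2] with w h h1 h2 hw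
      rw [PiLp.add_apply, h, Pi.add_apply, h1 hw, h2 hw, add_zero]
    · filter_upwards [h, hF3, hG3] with w h h1 h2
      rw [PiLp.add_apply, h, Pi.add_apply]
      exact (norm_add_le _ _).trans (add_le_add h1 h2)
  smul_mem' := by
    rintro c F ⟨hF1, hF2, C, hF3⟩
    have h := Lp.coeFn_smul c (F a.1)
    refine ⟨fun j hj => by simp [hF1 j hj], ?_, ‖c‖ * C, ?_⟩
    · filter_upwards [h, hF2] with w h h1 hw
      rw [PiLp.smul_apply, h, Pi.smul_apply, h1 hw, smul_zero]
    · filter_upwards [h, hF3] with w h h1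
      rw [PiLp.smul_apply, h, Pi.smul_apply, norm_smul]
      gcongr

theorem measurable_sample (θ : Fin n → ℝ) (F : L2Rn n) (a : Fin n × ℤ) :
    Measurable (sample θ F a) :=
  (Lp.stronglyMeasurable (F a.1)).measurable.comp (measurable_add_const _)

theorem ae_comp_add {p : ℝ → Prop} (h : ∀ᵐ w, p w) (c : ℝ) : ∀ᵐ w, p (w + c) :=
  (measurePreserving_add_right volume c).quasiMeasurePreserving.ae h

theorem memLp_sample (θ : Fin n → ℝ) (F : L2Rn n) (a : Fin n × ℤ) :
    MemLp (sample θ F a) 2 volume :=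
  (Lp.memLp (F a.1)).comp_measurePreserving (measurePreserving_add_right volume _)

theorem integrable_conj_sample_mul (θ : Fin n → ℝ) (e F : L2Rn n) (a : Fin n × ℤ) :
    Integrable (fun w => conj (sample θ e a w) * sample θ F a w) volume :=
  (memLp_sample θ e a).star.integrable_mul (memLp_sample θ F a)

theorem add_cellStart_mem_iff (θ : Fin n → ℝ) (a : Fin n × ℤ) (w : ℝ) :
    w + cellStart θ a ∈ Set.Ioc (cellStart θ a) (cellStart θ a + 1) ↔ w ∈ Set.Ioc (0 : ℝ) 1 := by
  simp only [Set.mem_Ioc]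
  constructor <;> rintro ⟨h1, h2⟩ <;> constructor <;> linarith

theorem inner_of_mem_cell {θ : Fin n → ℝ} {a : Fin n × ℤ} {F : L2Rn n} (hF : F ∈ cell θ a)
    (e : L2Rn n) :
    inner ℂ e F = ∫ w in Set.Ioc (0 : ℝ) 1, conj (sample θ e a w) * sample θ F a w := by
  rw [PiLp.inner_apply, Finset.sum_eq_single a.1 (fun j _ hj => by simp [hF.1 j hj]) (by simp),
    L2.inner_def, ← integral_add_right_eq_self _ (cellStart θ a),
    setIntegral_eq_integral_of_ae_compl_eq_zero]
  · refine integral_congr_ae (.of_forall fun w => ?_)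
    simp only [RCLike.inner_apply, sample]
    ring
  · filter_upwards [ae_comp_add hF.2.1 (cellStart θ a)] with w h hw
    rw [sample, sample, h (by rwa [add_cellStart_mem_iff]), mul_zero]

theorem inner_sum_of_mem_cell {θ : Fin n → ℝ} (S : Finset (Fin n × ℤ))
    {F : Fin n × ℤ → L2Rn n} (hF : ∀ a ∈ S, F a ∈ cell θ a) (e : L2Rn n) :
    inner ℂ e (∑ a ∈ S, F a) =
      ∫ w in Set.Ioc (0 : ℝ) 1, ∑ a ∈ S, conj (sample θ e a w) * sample θ (F a) a w := by
  rw [inner_sum, integral_finsetSum _ fun a _ =>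
    (integrable_conj_sample_mul θ e (F a) a).integrableOn]
  exact Finset.sum_congr rfl fun a ha => inner_of_mem_cell (hF a ha) e

theorem sample_eq_zero_of_mem_cell {θ : Fin n → ℝ} {a b : Fin n × ℤ} (hab : b ≠ a)
    {F : L2Rn n} (hF : F ∈ cell θ b) :
    ∀ᵐ w ∂volume.restrict (Set.Ioc (0 : ℝ) 1), sample θ F a w = 0 := by
  rw [ae_restrict_iff' measurableSet_Ioc]
  by_cases h : a.1 = b.1
  · filter_upwards [ae_comp_add hF.2.1 (cellStart θ a)] with w hw h01
    rw [sample, h]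
    refine hw fun hmem => hab ?_
    simp only [cellStart, h, Set.mem_Ioc] at hmem h01
    refine Prod.ext h.symm ?_
    -- Half-open unit cells of one component that share a point have integer offsets less than 1
    -- apart, hence equal.
    have h1 : (b.2 : ℝ) < a.2 + 1 := by linarith
    have h2 : (a.2 : ℝ) < b.2 + 1 := by linarith
    norm_cast at h1 h2
    lia
  · have h0 : ∀ᵐ w, (0 : L2R) w = 0 := Lp.coeFn_zero ℂ 2 volume
    filter_upwards [ae_comp_add h0 (cellStart θ a)] with w hw _
    rw [sample, hF.1 _ h, hw]

theorem sample_add (θ : Fin n → ℝ) (F G : L2Rn n) (a : Fin n × ℤ) :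
    ∀ᵐ w, sample θ (F + G) a w = sample θ F a w + sample θ G a w :=
  ae_comp_add (Lp.coeFn_add (F a.1) (G a.1)) _

theorem sample_sum_of_mem_cell {θ : Fin n → ℝ} (S : Finset (Fin n × ℤ))
    {F : Fin n × ℤ → L2Rn n} (hF : ∀ a ∈ S, F a ∈ cell θ a) {a : Fin n × ℤ} :
    ∀ᵐ w ∂volume.restrict (Set.Ioc (0 : ℝ) 1),
      sample θ (∑ b ∈ S, F b) a w = if a ∈ S then sample θ (F a) a w else 0 := by
  classical
  induction S using Finset.induction_on with
  | empty =>
    have h0 : ∀ᵐ w, (0 : L2R) w = 0 := Lp.coeFn_zero ℂ 2 volume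
    filter_upwards [ae_restrict_of_ae (ae_comp_add h0 (cellStart θ a))] with w hw
    simp [sample]
  | insert b S hb ih =>
    rw [Finset.sum_insert hb]
    have ih := ih fun c hc => hF c (Finset.mem_insert_of_mem hc)
    have hFb := hF b (Finset.mem_insert_self b S)
    by_cases hab : b = a
    · subst hab
      filter_upwards [ih, ae_restrict_of_ae (sample_add θ (F b) (∑ c ∈ S, F c) b)] with w h1 h2
      rw [h2, h1]; simp [hb]
    · filter_upwards [ih, ae_restrict_of_ae (sample_add θ (F b) (∑ c ∈ S, F c) a),
        sample_eq_zero_of_mem_cell hab hFb] with w h1 h2 h3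
      rw [h2, h1, h3]; simp [Ne.symm hab]

theorem enorm_sum_sq_of_mem_cell {θ : Fin n → ℝ} (S : Finset (Fin n × ℤ))
    {F : Fin n × ℤ → L2Rn n} (hF : ∀ a ∈ S, F a ∈ cell θ a) :
    ‖∑ a ∈ S, F a‖ₑ ^ 2 =
      ∫⁻ w in Set.Ioc (0 : ℝ) 1, ∑ a ∈ S, ‖sample θ (F a) a w‖ₑ ^ 2 := by
  have hint : ∀ a ∈ S, Integrable (fun w => ‖sample θ (F a) a w‖ ^ 2)
      (volume.restrict (Set.Ioc (0 : ℝ) 1)) := fun a _ =>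
    ((memLp_sample θ (F a) a).integrable_norm_pow (by simp)).integrableOn
  have h : ((‖∑ a ∈ S, F a‖ ^ 2 : ℝ) : ℂ) =
      ((∫ w in Set.Ioc (0 : ℝ) 1, ∑ a ∈ S, ‖sample θ (F a) a w‖ ^ 2 : ℝ) : ℂ) := by
    rw [← integral_complex_ofReal, Complex.ofReal_pow]
    refine (inner_self_eq_norm_sq_to_K _).symm.trans ((inner_sum_of_mem_cell S hF _).trans ?_)
    refine integral_congr_ae ?_
    have := (Finset.eventually_all S).2 fun a _ => sample_sum_of_mem_cell S hF (a := a)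
    filter_upwards [this] with w hw
    push_cast
    refine Finset.sum_congr rfl fun a ha => ?_
    rw [hw a ha, if_pos ha, Complex.conj_mul']
  rw [← ofReal_norm, ← ENNReal.ofReal_pow (norm_nonneg _), Complex.ofReal_injective h,
    ofReal_integral_eq_lintegral_ofReal (integrable_finsetSum S hint)
      (.of_forall fun w => Finset.sum_nonneg fun a _ => by positivity)]
  refine lintegral_congr fun w => ?_
  rw [ENNReal.ofReal_sum_of_nonneg fun a _ => by positivity]
  refine Finset.sum_congr rfl fun a _ => ?_
  rw [ENNReal.ofReal_pow (norm_nonneg _), ofReal_norm]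

/-- Modulation at frequency w + m - θ_i/(2π) yields an extra e^{ikθ_i}, cancelling the phase of T^k,
and e^{-2πikm} = 1. The remaining factor does not depend on the cell. -/
theorem sample_fourierRn_shift (θ : Fin n → ℝ) (k : ℤ) (φ : L2Rn n) (a : Fin n × ℤ) :
    ∀ᵐ w, sample θ (fourierRn n (shift θ k φ)) a w =
      Complex.exp (-(2 * Real.pi * Complex.I * k * w)) * sample θ (fourierRn n φ) a w := by
  have h1 : fourierRn n (shift θ k φ) a.1 =
      Complex.exp (-Complex.I * (k : ℂ) * (θ a.1 : ℂ)) • (𝓕 (translateL2 (k : ℝ) (φ a.1)) : L2R) :=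
    (Lp.fourierTransformₗᵢ ℝ ℂ).map_smul _ _
  have h2 := Lp.coeFn_smul (Complex.exp (-Complex.I * (k : ℂ) * (θ a.1 : ℂ)))
    (𝓕 (translateL2 (k : ℝ) (φ a.1)) : L2R)
  filter_upwards [ae_comp_add h2 (cellStart θ a),
    ae_comp_add (fourier_translateL2 (k : ℝ) (φ a.1)) (cellStart θ a)] with w h3 h4
  rw [sample, h1, h3, Pi.smul_apply, h4, sample, fourierRn_apply, smul_eq_mul, ← mul_assoc,
    ← Complex.exp_add]
  congr 1
  rw [Complex.exp_eq_exp_iff_exists_int]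
  refine ⟨-(k * a.2), ?_⟩
  have hpi : (Real.pi : ℂ) ≠ 0 := by exact_mod_cast Real.pi_ne_zero
  simp only [cellStart]
  push_cast
  field_simp
  ring

/-- Summing the squared coefficients of one generator over all shifts. -/
theorem tsum_enorm_inner_shift_sq {θ : Fin n → ℝ} (S : Finset (Fin n × ℤ))
    {F : Fin n × ℤ → L2Rn n} (hF : ∀ a ∈ S, F a ∈ cell θ a) {f : L2Rn n}
    (hf : fourierRn n f = ∑ a ∈ S, F a) (φ : L2Rn n) :
    ∑' k : ℤ, ‖inner ℂ (shift θ k φ) f‖ₑ ^ 2 = ∫⁻ w in Set.Ioc (0 : ℝ) 1,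
      ‖∑ a ∈ S, conj (sample θ (fourierRn n φ) a w) * sample θ (F a) a w‖ₑ ^ 2 := by
  have hb : MemLp (fun w => ∑ a ∈ S, conj (sample θ (fourierRn n φ) a w) * sample θ (F a) a w) 2
      (volume.restrict (Set.Ioc (0 : ℝ) 1)) := by
    refine memLp_finsetSum _ fun a ha => MemLp.restrict _ ?_
    -- Boundedness of cell elements is used here: a product of two L² functions need not be L², and
    -- Parseval needs it to be.
    obtain ⟨C, hC⟩ := (hF a ha).2.2
    refine (memLp_sample θ (fourierRn n φ) a).of_le_mul (c := C)
      (integrable_conj_sample_mul θ _ _ a).aestronglyMeasurable ?_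
    filter_upwards [ae_comp_add hC (cellStart θ a)] with w hw
    rw [norm_mul, RCLike.norm_conj, mul_comm]
    exact mul_le_mul_of_nonneg_right hw (norm_nonneg _)
  rw [← tsum_enorm_integral_exp_mul_sq hb]
  refine tsum_congr fun k => ?_
  rw [← (fourierRn n).inner_map_map, hf, inner_sum_of_mem_cell S hF]
  congr 2
  refine integral_congr_ae (ae_restrict_of_ae ?_)
  have := (Finset.eventually_all S).2 fun a _ => sample_fourierRn_shift θ k φ a
  filter_upwards [this] with w hw
  rw [Finset.mul_sum]
  refine Finset.sum_congr rfl fun a ha => ?_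
  rw [hw a ha, map_mul, ← Complex.exp_conj, mul_assoc]
  congr 2
  simp [Complex.conj_ofNat]

theorem ae_of_forall_ae_unitInterval {p : ℝ → Prop} (c : ℝ)
    (h : ∀ m : ℤ, ∀ᵐ w ∂volume.restrict (Set.Ioc (0 : ℝ) 1), p (w + (m + c))) :
    ∀ᵐ w, p w := by
  have h1 : ∀ m : ℤ, ∀ᵐ w : ℝ, w - (m + c) ∈ Set.Ioc (0 : ℝ) 1 → p w := fun m => by
    have := ae_comp_add ((ae_restrict_iff' measurableSet_Ioc).1 (h m)) (-(m + c))
    simpa only [← sub_eq_add_neg, sub_add_cancel] using this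
  filter_upwards [ae_all_iff.2 h1] with w hw
  -- Intervals open on the left require ⌈·⌉ - 1 rather than the floor.
  refine hw (⌈w - c⌉ - 1) ⟨?_, ?_⟩
  · have := Int.ceil_lt_add_one (w - c); push_cast; linarith
  · have := Int.le_ceil (w - c); push_cast; linarith

/-! ### Test vectors and density of the cells -/

theorem exists_mem_cell_indicator (θ : Fin n → ℝ) (a : Fin n × ℤ) (z : ℂ) {E : Set ℝ}
    (hE : MeasurableSet E) :
    ∃ F ∈ cell θ a, ∀ᵐ w ∂volume.restrict (Set.Ioc (0 : ℝ) 1),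
      sample θ F a w = E.indicator (fun _ => z) w := by
  set E' : Set ℝ := (fun x => x - cellStart θ a) ⁻¹' (E ∩ Set.Ioc 0 1) with hE'
  have hm : MeasurableSet E' := (hE.inter measurableSet_Ioc).preimage (measurable_sub_const _)
  have hfin : volume E' ≠ ⊤ := by
    rw [hE', (measurePreserving_sub_right volume _).measure_preimage
      (hE.inter measurableSet_Ioc).nullMeasurableSet]
    exact ((measure_mono Set.inter_subset_right).trans_lt (by simp)).ne
  have hc : indicatorConstLp 2 hm hfin z =ᵐ[volume] E'.indicator fun _ => z :=
    indicatorConstLp_coeFn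
  refine ⟨WithLp.toLp 2 (Pi.single a.1 (indicatorConstLp 2 hm hfin z)), ⟨?_, ?_, ‖z‖, ?_⟩, ?_⟩
  · intro j hj
    simp [hj]
  · filter_upwards [hc] with w hw hw'
    rw [Pi.single_eq_same, hw]
    refine Set.indicator_of_notMem (fun h => hw' ?_) _
    have h1 := (add_cellStart_mem_iff θ a _).2 h.2
    rwa [sub_add_cancel] at h1
  · filter_upwards [hc] with w hw
    rw [Pi.single_eq_same, hw]
    exact norm_indicator_le_norm_self _ _
  · rw [ae_restrict_iff' measurableSet_Ioc]
    filter_upwards [ae_comp_add hc (cellStart θ a)] with w hw h01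
    rw [sample, PiLp.toLp_apply, Pi.single_eq_same, hw]
    have hiff : w + cellStart θ a ∈ E' ↔ w ∈ E := by
      rw [hE', Set.mem_preimage, add_sub_cancel_right]
      exact and_iff_left h01
    by_cases h : w ∈ E <;> simp [hiff, h]

/-- A vector orthogonal to every cell integrates to zero against each indicator in each cell, so all
its entries vanish almost everywhere, and the cells exhaust the line. -/
theorem dense_iSup_cell (θ : Fin n → ℝ) :
    Dense ((⨆ a, cell θ a : Submodule ℂ (L2Rn n)) : Set (L2Rn n)) := by
  rw [Submodule.dense_iff_topologicalClosure_eq_top, Submodule.topologicalClosure_eq_top_iff,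
    Submodule.eq_bot_iff]
  intro F hF
  have hs : ∀ a, ∀ᵐ w ∂volume.restrict (Set.Ioc (0 : ℝ) 1), sample θ F a w = 0 := by
    intro a
    have h0 : (fun w => conj (sample θ F a w)) =ᵐ[volume.restrict (Set.Ioc (0 : ℝ) 1)] 0 := by
      have hint : Integrable (fun w => conj (sample θ F a w))
          (volume.restrict (Set.Ioc (0 : ℝ) 1)) :=
        ((memLp_sample θ F a).star.restrict _).integrable (by norm_num)
      refine hint.ae_eq_zero_of_forall_setIntegral_eq_zero fun E hE _ => ?_
      obtain ⟨G, hG, hGE⟩ := exists_mem_cell_indicator θ a 1 hE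
      have h1 : inner ℂ F G = 0 :=
        Submodule.inner_left_of_mem_orthogonal (Submodule.mem_iSup_of_mem a hG) hF
      rw [inner_of_mem_cell hG] at h1
      rw [← integral_indicator hE, ← h1]
      refine integral_congr_ae ?_
      filter_upwards [hGE] with w hw
      rw [hw]
      by_cases h : w ∈ E <;> simp [h]
    filter_upwards [h0] with w hw
    simpa using hw
  refine PiLp.ext fun i => Lp.ext ?_
  have h0 : ∀ᵐ w, (0 : L2R) w = 0 := Lp.coeFn_zero ℂ 2 volume
  have h1 : ∀ᵐ w, F i w = 0 :=
    ae_of_forall_ae_unitInterval (-(θ i / (2 * Real.pi))) fun m => by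
      simpa [sample, cellStart, sub_eq_add_neg] using hs (i, m)
  filter_upwards [h0, h1] with w h0 h1
  exact h1.trans h0.symm

/-- Countability of `Φ` permits exchanging its sum with the integral (Tonelli). -/
theorem tsum_enorm_inner_frame_sq {θ : Fin n → ℝ} {Φ : Set (L2Rn n)} (hΦ : Φ.Countable)
    (S : Finset (Fin n × ℤ)) {F : Fin n × ℤ → L2Rn n} (hF : ∀ a ∈ S, F a ∈ cell θ a) {f : L2Rn n}
    (hf : fourierRn n f = ∑ a ∈ S, F a) :
    ∑' p : ℤ × Φ, ‖inner ℂ (shift θ p.1 (p.2 : L2Rn n)) f‖ₑ ^ 2 =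
      ∫⁻ w in Set.Ioc (0 : ℝ) 1, ∑' φ : Φ,
        ‖∑ a ∈ S, conj (sample θ (fourierRn n φ) a w) * sample θ (F a) a w‖ₑ ^ 2 := by
  have := hΦ.to_subtype
  rw [ENNReal.tsum_prod (f := fun (k : ℤ) (φ : Φ) => ‖inner ℂ (shift θ k (φ : L2Rn n)) f‖ₑ ^ 2),
    ENNReal.tsum_comm, lintegral_tsum]
  · exact tsum_congr fun φ => tsum_enorm_inner_shift_sq S hF hf φ
  · intro φ
    refine (Measurable.pow_const (Measurable.enorm ?_) 2).aemeasurable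
    exact Finset.measurable_sum _ fun a _ =>
      (Complex.continuous_conj.measurable.comp (measurable_sample θ _ a)).mul (measurable_sample θ _ a)

/-! ### Gram relations versus the frame identity -/

/-- Vectors with orthonormal Gram sums satisfy Parseval's identity on finite combinations. -/
theorem tsum_enorm_sum_conj_mul_sq {ι A : Type*} [DecidableEq A] (x : ι → A → ℂ) (S : Finset A)
    (h : ∀ a ∈ S, ∀ b ∈ S, HasSum (fun i => x i a * conj (x i b)) (if a = b then 1 else 0))
    (z : A → ℂ) :
    ∑' i, ‖∑ a ∈ S, conj (x i a) * z a‖ₑ ^ 2 = ∑ a ∈ S, ‖z a‖ₑ ^ 2 := by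
  have h1 : HasSum (fun i => ((‖∑ a ∈ S, conj (x i a) * z a‖ ^ 2 : ℝ) : ℂ))
      ((∑ a ∈ S, ‖z a‖ ^ 2 : ℝ) : ℂ) := by
    have h2 := hasSum_sum fun a ha => hasSum_sum fun b hb =>
      (h a ha b hb).mul_right (conj (z a) * z b)
    have h3 : (∑ a ∈ S, ∑ b ∈ S, (if a = b then 1 else 0) * (conj (z a) * z b) : ℂ) =
        ((∑ a ∈ S, ‖z a‖ ^ 2 : ℝ) : ℂ) := by
      push_cast
      refine Finset.sum_congr rfl fun a ha => ?_
      simp [Complex.conj_mul', ha]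
    rw [← h3]
    refine (congrArg (fun f => HasSum f _) (funext fun i => ?_)).mpr h2
    rw [Complex.ofReal_pow, ← Complex.conj_mul', map_sum, Finset.sum_mul_sum]
    refine Finset.sum_congr rfl fun a _ => Finset.sum_congr rfl fun b _ => ?_
    simp only [map_mul, Complex.conj_conj]
    ring
  rw [Complex.hasSum_ofReal] at h1
  have h3 := ENNReal.ofReal_tsum_of_nonneg (fun _ => by positivity) h1.summable
  rw [h1.tsum_eq, ENNReal.ofReal_sum_of_nonneg fun _ _ => by positivity] at h3
  simpa only [ENNReal.ofReal_pow (norm_nonneg _), ofReal_norm] using h3.symm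

/-- Polarization: an orthogonality relation from Parseval sums. -/
theorem hasSum_mul_conj_eq_zero {ι : Type*} (x y : ι → ℂ)
    (h : ∀ β ∈ ({1, -1, Complex.I, -Complex.I} : Finset ℂ),
      ∑' i, ‖conj (x i) + conj (y i) * β‖ₑ ^ 2 = 2) :
    HasSum (fun i => x i * conj (y i)) 0 := by
  have h1 : ∀ β ∈ ({1, -1, Complex.I, -Complex.I} : Finset ℂ),
      HasSum (fun i => ((‖conj (x i) + conj (y i) * β‖ : ℝ) : ℂ) ^ 2) 2 := fun β hβ => by
    have h2 := (hasSum_norm_sq_iff_tsum_enorm (fun i => conj (x i) + conj (y i) * β)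
      (Real.sqrt 2)).2 (by
        rw [h β hβ, ← ofReal_norm, Real.norm_of_nonneg (Real.sqrt_nonneg _),
          ← ENNReal.ofReal_pow (Real.sqrt_nonneg _), Real.sq_sqrt (by norm_num)]
        simp)
    rw [Real.norm_of_nonneg (Real.sqrt_nonneg _), Real.sq_sqrt (by norm_num)] at h2
    simpa only [Complex.ofReal_pow, Complex.ofReal_ofNat] using Complex.hasSum_ofReal.2 h2
  -- The four sums all equal 2, so their polarization combination cancels.
  have h2 := (((h1 1 (by simp)).sub (h1 (-1) (by simp))).add
    (((h1 (-Complex.I) (by simp)).sub (h1 Complex.I (by simp))).mul_right Complex.I)).div_const 4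
  have h3 : ((2 - 2 + (2 - 2) * Complex.I) / 4 : ℂ) = 0 := by simp
  rw [h3] at h2
  refine (congrArg (fun f => HasSum f _) (funext fun i => ?_)).mpr h2
  have := inner_eq_sum_norm_sq_div_four (𝕜 := ℂ) (conj (x i)) (conj (y i))
  simp only [RCLike.inner_apply, Complex.conj_conj, smul_eq_mul] at this
  rw [mul_comm, this]
  simp [sub_eq_add_neg, mul_comm]

/-- The Gram relations of the Fourier fibers on the unit interval. -/
def FiberGram (θ : Fin n → ℝ) (Φ : Set (L2Rn n)) : Prop :=
  ∀ a b : Fin n × ℤ, ∀ᵐ w ∂volume.restrict (Set.Ioc (0 : ℝ) 1),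
    HasSum (fun φ : Φ => sample θ (fourierRn n φ) a w * conj (sample θ (fourierRn n φ) b w))
      (if a = b then 1 else 0)

theorem isNTFGenerator_top_iff (θ : Fin n → ℝ) (Φ : Set (L2Rn n)) :
    IsNTFGenerator θ ⊤ Φ ↔ ∀ f, HasSum
      (fun p : ℤ × Φ => ‖inner ℂ (shift θ p.1 (p.2 : L2Rn n)) f‖ ^ 2) (‖f‖ ^ 2) :=
  ⟨fun h f => h.frame.2 f trivial, fun h =>
    ⟨fun _ _ _ => trivial, fun _ _ => trivial, fun _ => trivial, fun f _ => h f⟩⟩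

theorem FiberGram.isNTFGenerator {θ : Fin n → ℝ} {Φ : Set (L2Rn n)} (hΦ : Φ.Countable)
    (h : FiberGram θ Φ) : IsNTFGenerator θ ⊤ Φ := by
  rw [isNTFGenerator_top_iff]
  refine hasSum_norm_inner_sq_of_dense _
    ((dense_iSup_cell θ).preimage (fourierRn n).toHomeomorph.isOpenMap) fun f hf => ?_
  obtain ⟨F, hF, hsum⟩ := (Submodule.mem_iSup_iff_exists_finsupp _ _).1 hf
  have hsum : fourierRn n f = ∑ a ∈ F.support, F a := hsum.symm
  rw [hasSum_norm_sq_iff_tsum_enorm, tsum_enorm_inner_frame_sq hΦ F.support (fun a _ => hF a) hsum,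
    ← (fourierRn n).enorm_map f, hsum, enorm_sum_sq_of_mem_cell F.support fun a _ => hF a]
  refine lintegral_congr_ae ?_
  have := (Finset.eventually_all F.support).2 fun a _ =>
    (Finset.eventually_all F.support).2 fun b _ => h a b
  filter_upwards [this] with w hw
  exact tsum_enorm_sum_conj_mul_sq _ F.support hw _

/-- Applying the frame identity to the vector with constant fiber `z` over a measurable set `E`
equates the integrals of both sides over `E`; arbitrariness of `E` gives the pointwise identity. The
null set depends on `S` and `z`, which is harmless since only finitely many choices are needed for
each Gram entry. -/
theorem IsNTFGenerator.ae_tsum_eq {θ : Fin n → ℝ} {Φ : Set (L2Rn n)} (hΦ : Φ.Countable)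
    (h : IsNTFGenerator θ ⊤ Φ) (S : Finset (Fin n × ℤ)) (z : Fin n × ℤ → ℂ) :
    ∀ᵐ w ∂volume.restrict (Set.Ioc (0 : ℝ) 1),
      ∑' φ : Φ, ‖∑ a ∈ S, conj (sample θ (fourierRn n φ) a w) * z a‖ₑ ^ 2 =
        ∑ a ∈ S, ‖z a‖ₑ ^ 2 := by
  have := hΦ.to_subtype
  refine ae_eq_of_forall_setLIntegral_eq_of_sigmaFinite (Measurable.tsum fun φ => ?_)
    measurable_const fun E hE _ => ?_
  · refine Measurable.pow_const (Measurable.enorm ?_) 2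
    exact Finset.measurable_sum _ fun a _ =>
      (Complex.continuous_conj.measurable.comp (measurable_sample θ _ a)).mul_const _
  choose F hF hFE using fun a => exists_mem_cell_indicator θ a (z a) hE
  have hf : fourierRn n ((fourierRn n).symm (∑ a ∈ S, F a)) = ∑ a ∈ S, F a :=
    (fourierRn n).apply_symm_apply _
  have h1 := (isNTFGenerator_top_iff θ Φ).1 h ((fourierRn n).symm (∑ a ∈ S, F a))
  rw [hasSum_norm_sq_iff_tsum_enorm, tsum_enorm_inner_frame_sq hΦ S (fun a _ => hF a) hf,
    (fourierRn n).symm.enorm_map, enorm_sum_sq_of_mem_cell S fun a _ => hF a] at h1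
  have hall := (Finset.eventually_all S).2 fun a _ => hFE a
  rw [← lintegral_indicator hE, ← lintegral_indicator hE]
  refine Eq.trans (lintegral_congr_ae ?_) (h1.trans (lintegral_congr_ae ?_))
  · filter_upwards [hall] with w hw
    by_cases hwE : w ∈ E
    · simp only [Set.indicator_of_mem hwE] at hw ⊢
      refine tsum_congr fun φ => ?_
      congr 2
      exact Finset.sum_congr rfl fun a ha => by rw [hw a ha]
    · simp only [Set.indicator_of_notMem hwE] at hw ⊢
      symm
      refine ENNReal.tsum_eq_zero.2 fun φ => ?_
      rw [Finset.sum_eq_zero fun a ha => by rw [hw a ha, mul_zero]]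
      simp
  · filter_upwards [hall] with w hw
    by_cases hwE : w ∈ E
    · simp only [Set.indicator_of_mem hwE] at hw ⊢
      exact Finset.sum_congr rfl fun a ha => by rw [hw a ha]
    · simp only [Set.indicator_of_notMem hwE] at hw ⊢
      exact Finset.sum_eq_zero fun a ha => by rw [hw a ha]; simp

theorem IsNTFGenerator.fiberGram {θ : Fin n → ℝ} {Φ : Set (L2Rn n)} (hΦ : Φ.Countable)
    (h : IsNTFGenerator θ ⊤ Φ) : FiberGram θ Φ := by
  intro a b
  by_cases hab : a = b
  · subst hab
    filter_upwards [h.ae_tsum_eq hΦ {a} fun _ => 1] with w hw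
    simp only [Finset.sum_singleton, mul_one] at hw
    have h1 := (hasSum_norm_sq_iff_tsum_enorm _ (1 : ℂ)).2 hw
    simp only [RCLike.norm_conj, norm_one, one_pow] at h1
    have h2 := Complex.hasSum_ofReal.2 h1
    simpa [Complex.mul_conj'] using h2
  · have key : ∀ β ∈ ({1, -1, Complex.I, -Complex.I} : Finset ℂ),
        ∀ᵐ w ∂volume.restrict (Set.Ioc (0 : ℝ) 1),
        ∑' φ : Φ, ‖conj (sample θ (fourierRn n φ) a w) +
          conj (sample θ (fourierRn n φ) b w) * β‖ₑ ^ 2 = 2 := fun β hβ => by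
      filter_upwards [h.ae_tsum_eq hΦ {a, b} fun t => if t = a then 1 else β] with w hw
      have hβ1 : ‖β‖ = 1 := by
        simp only [Finset.mem_insert, Finset.mem_singleton] at hβ
        rcases hβ with rfl | rfl | rfl | rfl <;> simp
      have hβ' : ‖β‖ₑ = 1 := by rw [← ofReal_norm, hβ1, ENNReal.ofReal_one]
      simpa [Finset.sum_pair hab, Ne.symm hab, hβ', one_add_one_eq_two] using hw
    filter_upwards [(Finset.eventually_all _).2 key] with w hw
    rw [if_neg hab]
    exact hasSum_mul_conj_eq_zero _ _ hw

/-! ### Return to the variable ξ -/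

theorem quasiMeasurePreserving_mul_left {c : ℝ} (hc : c ≠ 0) :
    Measure.QuasiMeasurePreserving (fun w : ℝ => c * w) volume volume := by
  refine ⟨measurable_const_mul c, ?_⟩
  rw [Real.map_volume_mul_left hc]
  exact Measure.smul_absolutelyContinuous

theorem fourierHat_two_pi_mul (θ : Fin n → ℝ) (φ : L2Rn n) (a : Fin n × ℤ) (w ξ : ℝ)
    (hξ : ξ = 2 * Real.pi * (w + a.2) - θ a.1) :
    fourierHat (φ a.1) ξ = sample θ (fourierRn n φ) a w := by
  rw [fourierHat, sample, fourierRn_apply, hξ]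
  congr 1
  simp only [cellStart]
  field_simp
  ring

theorem fiberGram_iff (θ : Fin n → ℝ) (Φ : Set (L2Rn n)) :
    FiberGram θ Φ ↔ ∀ (i j : Fin n) (k : ℤ), ∀ᵐ ξ : ℝ ∂volume,
        HasSum
          (fun φ : Φ => fourierHat ((φ : L2Rn n) i) (ξ - θ i) *
            conj (fourierHat ((φ : L2Rn n) j) (ξ - θ j + 2 * (k : ℝ) * Real.pi)))
          (if i = j ∧ k = 0 then (1 : ℂ) else 0) := by
  have hpt : ∀ (i j : Fin n) (k m : ℤ) (w : ℝ),
      HasSum (fun φ : Φ => sample θ (fourierRn n φ) (i, m) w *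
          conj (sample θ (fourierRn n φ) (j, m + k) w))
        (if (i, m) = (j, m + k) then 1 else 0) ↔
      HasSum
          (fun φ : Φ => fourierHat ((φ : L2Rn n) i) (2 * Real.pi * (w + m) - θ i) *
            conj (fourierHat ((φ : L2Rn n) j)
              (2 * Real.pi * (w + m) - θ j + 2 * (k : ℝ) * Real.pi)))
          (if i = j ∧ k = 0 then (1 : ℂ) else 0) := by
    intro i j k m w
    have h1 : ∀ φ : L2Rn n, fourierHat (φ i) (2 * Real.pi * (w + m) - θ i) =
        sample θ (fourierRn n φ) (i, m) w := fun φ => fourierHat_two_pi_mul θ φ (i, m) w _ rfl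
    have h2 : ∀ φ : L2Rn n,
        fourierHat (φ j) (2 * Real.pi * (w + m) - θ j + 2 * (k : ℝ) * Real.pi) =
        sample θ (fourierRn n φ) (j, m + k) w := fun φ =>
      fourierHat_two_pi_mul θ φ (j, m + k) w _ (by push_cast; ring)
    simp only [h1, h2, Prod.mk.injEq, left_eq_add]
  have hpi : (2 * Real.pi) ≠ 0 := by positivity
  constructor
  · intro h i j k
    have h1 := ae_of_forall_ae_unitInterval
      (p := fun w => HasSum
          (fun φ : Φ => fourierHat ((φ : L2Rn n) i) (2 * Real.pi * w - θ i) *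
            conj (fourierHat ((φ : L2Rn n) j) (2 * Real.pi * w - θ j + 2 * (k : ℝ) * Real.pi)))
          (if i = j ∧ k = 0 then (1 : ℂ) else 0)) 0 fun m => by
      filter_upwards [h (i, m) (j, m + k)] with w hw
      rw [add_zero]
      exact (hpt i j k m w).1 hw
    filter_upwards [(quasiMeasurePreserving_mul_left (inv_ne_zero hpi)).ae h1] with ξ hξ
    rwa [mul_inv_cancel_left₀ hpi] at hξ
  · rintro h ⟨i, m⟩ ⟨j, l⟩
    -- Only the difference l - m of the cell numbers enters as k; the common offset m is absorbed
    -- into ξ.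
    have h1 := ae_comp_add ((quasiMeasurePreserving_mul_left hpi).ae (h i j (l - m))) m
    filter_upwards [ae_restrict_of_ae h1] with w hw
    have := (hpt i j (l - m) m w).2 hw
    rwa [add_sub_cancel] at this

end SuperWavelet

end

theorem mainTheorem6 {n : ℕ} (θ : Fin n → ℝ) (Φ : Set (SuperWavelet.L2Rn n))
    (hΦ : Φ.Countable) :
    SuperWavelet.IsNTFGenerator θ ⊤ Φ ↔
      ∀ (i j : Fin n) (k : ℤ), ∀ᵐ ξ : ℝ ∂volume,
        HasSum
          (fun φ : Φ =>
            SuperWavelet.fourierHat ((φ : SuperWavelet.L2Rn n) i) (ξ - θ i) *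
              conj (SuperWavelet.fourierHat ((φ : SuperWavelet.L2Rn n) j)
                (ξ - θ j + 2 * (k : ℝ) * Real.pi)))
          (if i = j ∧ k = 0 then (1 : ℂ) else 0) := by
  rw [← SuperWavelet.fiberGram_iff]
  exact ⟨fun h => h.fiberGram hΦ, fun h => h.isNTFGenerator hΦ⟩
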